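/- Let $n,k\ge 0$ be integers. Write $\mathrm{Sp}(n)$ for the group of quaternionic $n\times n$ matrices $q$ with $q^\dagger q=qq^\dagger=I_n$ (so $\mathrm{Sp}(1)$ is the group of unit quaternions), $\mathfrak{sp}(1)$ for the Lie algebra of imaginary quaternions with the commutator bracket, and $\mathfrak{so}(k)$ for the Lie algebra of real skew-symmetric $k\times k$ matrices. Let $\mathcal M$ be the set of $(n+k)\times k$ quaternionic matrices $\hat M=\begin{bmatrix}L\\ M\end{bmatrix}$, with $L$ of size $n\times k$ and $M$ of size $k\times k$, such that 1. $M=M_1i+M_2j+M_3k$ with $M_1,M_2,M_3$ real symmetric matrices; 2. $LL^\dagger$ is positive definite; 3. $L^\dagger L-M^2=I_k$; 4. for every $x\in\mathbb H$, with $\Delta(x):=\begin{bmatrix}L\\ M-I_kx\end{bmatrix}$, the matrix $\Delta(x)^\dagger\Delta(x)$ is non-singular. For $(q,Q)\in\mathrm{Sp}(n)\times\mathrm O(k)$ put $(q,Q).\hat M:=\begin{bmatrix}qLQ^T\\ QMQ^T\end{bmatrix}$ (gauge action), and for $p\in\mathrm{Sp}(1)$ put $p.\hat M:=p\hat Mp^\dagger$,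 i.e. every entry $a$ is replaced by $pap^\dagger$ (rotation action). Call $\hat M\in\mathcal M$ spherically symmetric if for every $p\in\mathrm{Sp}(1)$ there is $(q,Q)\in\mathrm{Sp}(n)\times\mathrm O(k)$ with $p.\hat M=(q,Q).\hat M$, that is, if the gauge class of $\hat M$ is fixed by every $p\in\mathrm{Sp}(1)$. **Theorem.** Let $\hat M\in\mathcal M$. Then $\hat M$ is spherically symmetric if and only if there exists a real representation $(\mathbb R^k,\rho)$ of $\mathfrak{sp}(1)$, given by a Lie algebra homomorphism $\rho:\mathfrak{sp}(1)\to\mathfrak{so}(k)$, such that for all $\upsilon\in\mathfrak{sp}(1)$ $$[M,\rho(\upsilon)]=[\upsilon,M],$$ where $[M,\rho(\upsilon)]=M\rho(\upsilon)-\rho(\upsilon)M$ and $[\upsilon,M]=\upsilon M-M\upsilon$, with $\upsilon$ multiplying every entry of $M$. -/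

import Mathlib

open scoped Quaternion Matrix

/- The commutator bracket on associative rings, as a Lie ring structure. -/
attribute [local instance 100] LieRing.ofAssociativeRing

namespace HyperbolicMonopole

/-- The compact symplectic group `Sp(n)`: quaternionic `n × n` matrices `q` with
`q† q = q q† = 1`. -/
noncomputable abbrev Sp (n : ℕ) : Submonoid (Matrix (Fin n) (Fin n) ℍ[ℝ]) :=
  unitary (Matrix (Fin n) (Fin n) ℍ[ℝ])

/-- `Sp(1)` as the group of unit quaternions. -/
noncomputable abbrev UnitQuaternion : Submonoid ℍ[ℝ] := unitary ℍ[ℝ]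

/-- The Lie algebra `sp(1)` of imaginary quaternions, with the commutator bracket. -/
noncomputable def sp1 : LieSubalgebra ℝ ℍ[ℝ] where
  carrier := {x | star x = -x}
  zero_mem' := by simp
  add_mem' := by
    intro x y hx hy
    simp only [Set.mem_ofPred_eq] at hx hy ⊢
    rw [star_add, hx, hy, neg_add]
  smul_mem' := by
    intro c x hx
    simp only [Set.mem_ofPred_eq] at hx ⊢
    rw [Quaternion.star_smul, hx, smul_neg]
  lie_mem' := by
    intro x y hx hy
    change star ⁅x, y⁆ = -⁅x, y⁆
    change star x = -x at hx
    change star y = -y at hy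
    rw [Ring.lie_def, star_sub, star_mul, star_mul, hx, hy]
    noncomm_ring

/-- The Lie algebra `so(k)` of real skew-symmetric `k × k` matrices. -/
abbrev so (k : ℕ) : LieSubalgebra ℝ (Matrix (Fin k) (Fin k) ℝ) :=
  LieAlgebra.Orthogonal.so (Fin k) ℝ

/-- A real matrix regarded as a quaternionic matrix. -/
noncomputable abbrev toQuat {k : ℕ} (A : Matrix (Fin k) (Fin k) ℝ) : Matrix (Fin k) (Fin k) ℍ[ℝ] :=
  A.map (algebraMap ℝ ℍ[ℝ])

/-- Quaternionic `(n + k) × k` matrices. -/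
abbrev Mat (n k : ℕ) : Type := Matrix (Fin n ⊕ Fin k) (Fin k) ℍ[ℝ]

/-- The top block `L` (of size `n × k`). -/
abbrev Lpart {n k : ℕ} (A : Mat n k) : Matrix (Fin n) (Fin k) ℍ[ℝ] := A.toRows₁

/-- The bottom block `M` (of size `k × k`). -/
abbrev Mpart {n k : ℕ} (A : Mat n k) : Matrix (Fin k) (Fin k) ℍ[ℝ] := A.toRows₂

/-- Positive definiteness of a quaternionic matrix: `A† = A` and `x† A x > 0` for every nonzero
column vector `x` (the number `x† A x` is real because `A` is Hermitian). -/
def IsPosDef {n : ℕ} (A : Matrix (Fin n) (Fin n) ℍ[ℝ]) : Prop :=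
  A.IsHermitian ∧ ∀ x : Fin n → ℍ[ℝ], x ≠ 0 → 0 < (star x ⬝ᵥ (A *ᵥ x)).re

/-- `Δ(x)`, with blocks `L` and `M - I x`. -/
noncomputable def Delta {n k : ℕ} (A : Mat n k) (x : ℍ[ℝ]) : Mat n k :=
  Matrix.fromRows (Lpart A) (Mpart A - Matrix.scalar (Fin k) x)

/-- The set of monopole data, written `𝓜` in the literature. The first two conditions say
that `M = M₁ i + M₂ j + M₃ k` with `M₁, M₂, M₃` real and symmetric. -/
structure IsMonopoleData {n k : ℕ} (A : Mat n k) : Prop where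
  symm : (Mpart A).IsSymm
  imaginary : ∀ a b, (Mpart A a b).re = 0
  posDef : IsPosDef (Lpart A * (Lpart A)ᴴ)
  quadratic : (Lpart A)ᴴ * Lpart A - Mpart A ^ 2 = 1
  nonsingular : ∀ x : ℍ[ℝ], IsUnit ((Delta A x)ᴴ * Delta A x)

/-- The gauge action `(q, Q).A = diag(q, Q) A Qᵀ` of `Sp(n) × O(k)`. -/
noncomputable def gaugeAct {n k : ℕ} (g : Sp n × Matrix.orthogonalGroup (Fin k) ℝ) (A : Mat n k) : Mat n k :=
  Matrix.fromBlocks (g.1 : Matrix (Fin n) (Fin n) ℍ[ℝ]) 0 0 (toQuat g.2.1) * A * (toQuat g.2.1)ᵀ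

/-- The rotation action `p.A = p A p†` of `Sp(1)`. -/
noncomputable def rotateAct {n k : ℕ} (p : UnitQuaternion) (A : Mat n k) : Mat n k :=
  A.map fun a => (p : ℍ[ℝ]) * a * star (p : ℍ[ℝ])

/-- `A` is equivariant under `p`: the gauge class of `A` is fixed by the rotation `p`. -/
def IsEquivariant {n k : ℕ} (A : Mat n k) (p : UnitQuaternion) : Prop :=
  ∃ g : Sp n × Matrix.orthogonalGroup (Fin k) ℝ, rotateAct p A = gaugeAct g A

/-- `A` is spherically symmetric: it is equivariant under every unit quaternion. -/
def IsSphericallySymmetric {n k : ℕ} (A : Mat n k) : Prop :=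
  ∀ p : UnitQuaternion, IsEquivariant A p

end HyperbolicMonopole

/-! Since `L†L = 1 + M²` and `LL†` is invertible, `M` determines `L` up to a left factor in `Sp(n)`.
Equivariance under `p` therefore amounts to `p M p†` lying in the `O(k)`-orbit of `M`
(`IsEquivariant.exists_orthogonal`, `IsMonopoleData.isEquivariant_of_orthogonal`).

Given `ρ`, the matrix `M` commutes with `υ + ρ(υ)`. The two summands commute with each other, so `M`
commutes with `exp υ · exp ρ(υ)`. Every unit quaternion is such an `exp υ`.

Conversely, one must differentiate a family of orthogonal matrices chosen with no continuity in `p`.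
Conjugation by `1 + tυ` is realised by some orthogonal `Q`; taking `Q` of maximal trace, that is,
closest to the identity, forces `Q → 1` along a subsequence and puts `Q - 1` in the trace-orthogonal
complement of the stabilizer algebra of `M`. There the linearised equations are injective, and a
limit argument yields a skew `R` with `[M, R] = [υ, M]`. Such an `R` in the complement is unique,
and uniqueness makes `υ ↦ R` linear and bracket-preserving. -/

namespace HyperbolicMonopole

open Filter Topology

attribute [local instance] Matrix.linftyOpNormedRing Matrix.linftyOpNormedAlgebra

/-! ### Approximate solutions of linear equations. -/

/-- A linear injection from a finite-dimensional space attains every limit direction of values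
that are approximated up to an error small relative to the argument. -/
theorem mem_range_of_tendsto_of_norm_sub_le {V W : Type*} [NormedAddCommGroup V] [NormedSpace ℝ V]
    [FiniteDimensional ℝ V] [NormedAddCommGroup W] [NormedSpace ℝ W] (F : V →ₗ[ℝ] W)
    (hF : Function.Injective F) (X : ℕ → V) (t e : ℕ → ℝ) (a : ℕ → W) (w : W)
    (ht : ∀ i, 0 < t i) (he : Tendsto e atTop (𝓝 0)) (ha : Tendsto a atTop (𝓝 w))
    (h : ∀ i, ‖F (X i) - t i • a i‖ ≤ ‖X i‖ * e i) : w ∈ LinearMap.range F := by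
  obtain ⟨C, hC0, hC⟩ := F.exists_antilipschitzWith (LinearMap.ker_eq_bot.2 hF)
  have hX : ∀ x : V, ‖x‖ ≤ C * ‖F x‖ := fun x => by
    simpa using hC.le_mul_dist x 0
  have hcl : IsClosed (LinearMap.range F : Set W) := Submodule.closed_of_finiteDimensional _
  -- Once `C|e| ≤ 1/2`, the error term is absorbed into `‖X‖`, leaving `‖X‖ ≤ 2C t ‖a‖`.
  have hev : ∀ᶠ i in atTop, (C : ℝ) * |e i| ≤ 1 / 2 := by
    have : Tendsto (fun i => (C : ℝ) * |e i|) atTop (𝓝 0) := by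
      simpa using (he.abs).const_mul (C : ℝ)
    exact this.eventually_le_const (by norm_num)
  have hbd : ∀ᶠ i in atTop, ‖F ((t i)⁻¹ • X i) - a i‖ ≤ 2 * C * ‖a i‖ * |e i| := by
    filter_upwards [hev] with i hi
    have ht' := ht i
    have h1 : ‖X i‖ ≤ 2 * C * (t i * ‖a i‖) := by
      have h2 : ‖F (X i)‖ ≤ t i * ‖a i‖ + ‖X i‖ * |e i| := by
        calc ‖F (X i)‖ = ‖(F (X i) - t i • a i) + t i • a i‖ := by rw [sub_add_cancel]
          _ ≤ ‖F (X i) - t i • a i‖ + ‖t i • a i‖ := norm_add_le _ _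
          _ ≤ ‖X i‖ * |e i| + t i * ‖a i‖ := by
            gcongr
            · exact (h i).trans (by gcongr; exact le_abs_self _)
            · rw [norm_smul, Real.norm_of_nonneg ht'.le]
          _ = _ := add_comm _ _
      have h3 : ‖X i‖ ≤ C * (t i * ‖a i‖ + ‖X i‖ * |e i|) :=
        (hX _).trans (by gcongr)
      have h4 : (C : ℝ) * |e i| * ‖X i‖ ≤ 1 / 2 * ‖X i‖ := by gcongr
      linarith
    have h5 : F ((t i)⁻¹ • X i) - a i = (t i)⁻¹ • (F (X i) - t i • a i) := by
      rw [map_smul, smul_sub, smul_smul, inv_mul_cancel₀ ht'.ne', one_smul]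
    rw [h5, norm_smul, norm_inv, Real.norm_of_nonneg ht'.le]
    calc (t i)⁻¹ * ‖F (X i) - t i • a i‖ ≤ (t i)⁻¹ * ((2 * C * (t i * ‖a i‖)) * |e i|) := by
          gcongr
          exact (h i).trans ((mul_le_mul_of_nonneg_left (le_abs_self _) (norm_nonneg _)).trans
            (by gcongr))
      _ = 2 * C * ‖a i‖ * |e i| := by field_simp
  have hz : Tendsto (fun i => F ((t i)⁻¹ • X i) - a i) atTop (𝓝 0) := by
    refine squeeze_zero_norm' hbd ?_
    simpa using (ha.norm.const_mul (2 * (C : ℝ))).mul he.abs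
  have hlim : Tendsto (fun i => F ((t i)⁻¹ • X i)) atTop (𝓝 w) := by
    simpa using hz.add ha
  exact hcl.mem_of_tendsto hlim (Eventually.of_forall fun i => ⟨_, rfl⟩)

/-! ### Gram matrices over the quaternions. -/

section Gram

variable {n k : ℕ}

/-- Positivity applied to each column makes left multiplication by `A` injective, hence surjective
on a finite-dimensional real space; no determinant is needed. -/
theorem IsPosDef.isUnit {A : Matrix (Fin n) (Fin n) ℍ[ℝ]} (hA : IsPosDef A) : IsUnit A := by
  have hinj : Function.Injective (LinearMap.mulLeft ℝ A) := by
    refine (injective_iff_map_eq_zero _).2 fun B hB => ?_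
    rw [LinearMap.mulLeft_apply] at hB
    ext1 i j
    by_contra hij
    have h0 : (fun i => B i j) ≠ 0 := fun h => hij (congrFun h i)
    have h1 : A *ᵥ (fun i => B i j) = 0 := by
      ext1 i
      exact congrFun (congrFun hB i) j
    simpa [h1] using hA.2 _ h0
  have hsurj := LinearMap.surjective_of_injective hinj
  obtain ⟨B, hB⟩ := hsurj 1
  rw [LinearMap.mulLeft_apply] at hB
  have hB' : B * A = 1 := hinj (by
    simp only [LinearMap.mulLeft_apply]
    rw [← mul_assoc, hB, one_mul, mul_one])
  exact ⟨⟨A, B, hB, hB'⟩, rfl⟩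

theorem conjTranspose_mul_self_eq_zero_iff {m l : ℕ} (A : Matrix (Fin m) (Fin l) ℍ[ℝ]) :
    Aᴴ * A = 0 ↔ A = 0 := by
  refine ⟨fun h => ?_, fun h => by simp [h]⟩
  ext1 i j
  have h1 : ((Aᴴ * A) j j).re = 0 := by rw [h]; rfl
  have h2 : ((Aᴴ * A) j j) = ((∑ i, Quaternion.normSq (A i j) : ℝ) : ℍ[ℝ]) := by
    simp only [Matrix.mul_apply, Matrix.conjTranspose_apply, Quaternion.star_mul_self]
    exact (map_sum (algebraMap ℝ ℍ[ℝ]) _ _).symm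
  rw [h2, Quaternion.re_coe] at h1
  have := (Finset.sum_eq_zero_iff_of_nonneg fun i _ => Quaternion.normSq_nonneg).1 h1 i
    (Finset.mem_univ _)
  exact Quaternion.normSq_eq_zero.1 this

/-- Two quaternionic matrices with the same Gram matrix differ by a symplectic factor, provided
that the first has full row rank. -/
theorem exists_symplectic_mul_eq {L L' : Matrix (Fin n) (Fin k) ℍ[ℝ]} (hL : IsPosDef (L * Lᴴ))
    (h : Lᴴ * L = L'ᴴ * L') : ∃ q : Sp n, L' = (q : Matrix (Fin n) (Fin n) ℍ[ℝ]) * L := by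
  obtain ⟨u, hu⟩ := hL.isUnit
  set G : Matrix (Fin n) (Fin n) ℍ[ℝ] := (↑u⁻¹ : Matrix (Fin n) (Fin n) ℍ[ℝ]) with hG
  have hG1 : G * (L * Lᴴ) = 1 := by rw [← hu, hG, Units.inv_mul]
  have hG2 : (L * Lᴴ) * G = 1 := by rw [← hu, hG, Units.mul_inv]
  have hGH : Gᴴ = G := by
    have h1 : (L * Lᴴ) * Gᴴ = 1 := by
      have := congrArg Matrix.conjTranspose hG1
      simpa [Matrix.conjTranspose_mul, mul_assoc, Matrix.mul_assoc] using this
    calc Gᴴ = G * (L * Lᴴ) * Gᴴ := by rw [hG1, one_mul]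
      _ = G := by rw [mul_assoc, h1, mul_one]
  -- `1 - L†GL` is the projector onto the kernel of `L`. Equal Gram matrices force `L'` to kill it
  -- too, so `q = L'L†G` satisfies `L' = qL`.
  have hker : L * (1 - Lᴴ * G * L) = 0 := by
    rw [Matrix.mul_sub, Matrix.mul_one, ← Matrix.mul_assoc, ← Matrix.mul_assoc, hG2,
      Matrix.one_mul, sub_self]
  have hker' : L' * (1 - Lᴴ * G * L) = 0 := by
    set E := 1 - Lᴴ * G * L
    rw [← conjTranspose_mul_self_eq_zero_iff, Matrix.conjTranspose_mul, Matrix.mul_assoc,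
      ← Matrix.mul_assoc L'ᴴ, ← h, Matrix.mul_assoc Lᴴ, hker, Matrix.mul_zero, Matrix.mul_zero]
  have hq : L' = L' * Lᴴ * G * L := by
    rw [Matrix.mul_sub, Matrix.mul_one, sub_eq_zero] at hker'
    simpa only [Matrix.mul_assoc] using hker'
  have hq1 : (L' * Lᴴ * G)ᴴ * (L' * Lᴴ * G) = 1 := by
    calc (L' * Lᴴ * G)ᴴ * (L' * Lᴴ * G) = G * L * (L'ᴴ * L') * Lᴴ * G := by
          simp only [Matrix.conjTranspose_mul, Matrix.conjTranspose_conjTranspose, hGH,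
            Matrix.mul_assoc]
      _ = (G * (L * Lᴴ)) * ((L * Lᴴ) * G) := by rw [← h]; simp only [Matrix.mul_assoc]
      _ = 1 := by rw [hG1, hG2, one_mul]
  have hq2 : (L' * Lᴴ * G) * (L' * Lᴴ * G)ᴴ = 1 := by
    have hinj : Function.Injective (LinearMap.mulLeft ℝ (L' * Lᴴ * G)) :=
      Function.LeftInverse.injective (g := LinearMap.mulLeft ℝ (L' * Lᴴ * G)ᴴ) fun B => by
        simp only [LinearMap.mulLeft_apply]
        rw [← mul_assoc, hq1, one_mul]
    obtain ⟨B, hB⟩ := LinearMap.surjective_of_injective hinj 1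
    rw [LinearMap.mulLeft_apply] at hB
    rw [left_inv_eq_right_inv hq1 hB, hB]
  exact ⟨⟨L' * Lᴴ * G, Unitary.mem_iff.2 ⟨hq1, hq2⟩⟩, hq⟩

end Gram

/-! ### Reduction of equivariance to the block `M`. -/

section Actions

variable {n k : ℕ}

theorem scalar_mul_toQuat (υ : ℍ[ℝ]) (R : Matrix (Fin k) (Fin k) ℝ) :
    Matrix.scalar (Fin k) υ * toQuat R = toQuat R * Matrix.scalar (Fin k) υ := by
  ext1 i j
  simp only [Matrix.scalar_apply, Matrix.diagonal_mul, Matrix.mul_diagonal, Matrix.map_apply]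
  exact (Algebra.commutes _ _).symm

theorem toQuat_mul (R S : Matrix (Fin k) (Fin k) ℝ) : toQuat (R * S) = toQuat R * toQuat S :=
  Matrix.map_mul

theorem toQuat_one : toQuat (1 : Matrix (Fin k) (Fin k) ℝ) = 1 :=
  map_one (algebraMap ℝ ℍ[ℝ]).mapMatrix

theorem toQuat_transpose (R : Matrix (Fin k) (Fin k) ℝ) : (toQuat R)ᵀ = toQuat Rᵀ := rfl

theorem toQuat_conjTranspose (R : Matrix (Fin k) (Fin k) ℝ) : (toQuat R)ᴴ = toQuat Rᵀ := by
  ext1 i j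
  exact Quaternion.star_coe _

theorem toQuat_mul_transpose {Q : Matrix (Fin k) (Fin k) ℝ} (hQ : Q * Qᵀ = 1) :
    toQuat Q * toQuat Qᵀ = 1 := by rw [← toQuat_mul, hQ, toQuat_one]

theorem mem_orthogonalGroup_iff_transpose {Q : Matrix (Fin k) (Fin k) ℝ} :
    Q ∈ Matrix.orthogonalGroup (Fin k) ℝ ↔ Q * Qᵀ = 1 :=
  Matrix.mem_orthogonalGroup_iff _ _

theorem rotateAct_eq (p : UnitQuaternion) (A : Mat n k) :
    rotateAct p A = Matrix.fromRows
      (Matrix.scalar (Fin n) (p : ℍ[ℝ]) * Lpart A * Matrix.scalar (Fin k) (star (p : ℍ[ℝ])))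
      (Matrix.scalar (Fin k) (p : ℍ[ℝ]) * Mpart A * Matrix.scalar (Fin k) (star (p : ℍ[ℝ]))) := by
  ext1 i j
  rcases i with i | i <;>
    simp [rotateAct, Matrix.diagonal_mul, Matrix.mul_diagonal]

theorem gaugeAct_eq (g : Sp n × Matrix.orthogonalGroup (Fin k) ℝ) (A : Mat n k) :
    gaugeAct g A = Matrix.fromRows
      ((g.1 : Matrix (Fin n) (Fin n) ℍ[ℝ]) * Lpart A * toQuat (g.2 : Matrix (Fin k) (Fin k) ℝ)ᵀ)
      (toQuat (g.2 : Matrix (Fin k) (Fin k) ℝ) * Mpart A *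
        toQuat (g.2 : Matrix (Fin k) (Fin k) ℝ)ᵀ) := by
  rw [gaugeAct, toQuat_transpose]
  conv_lhs => rw [← Matrix.fromRows_toRows A]
  rw [Matrix.fromBlocks_mul_fromRows, Matrix.fromRows_mul]
  simp

theorem scalar_mul_scalar_star {m : ℕ} (p : UnitQuaternion) :
    Matrix.scalar (Fin m) (p : ℍ[ℝ]) * Matrix.scalar (Fin m) (star (p : ℍ[ℝ])) = 1 := by
  rw [← map_mul, Unitary.mul_star_self_of_mem p.2, map_one]

theorem scalar_star_mul_scalar {m : ℕ} (p : UnitQuaternion) :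
    Matrix.scalar (Fin m) (star (p : ℍ[ℝ])) * Matrix.scalar (Fin m) (p : ℍ[ℝ]) = 1 := by
  rw [← map_mul, Unitary.star_mul_self_of_mem p.2, map_one]

theorem IsEquivariant.exists_orthogonal {A : Mat n k} {p : UnitQuaternion}
    (h : IsEquivariant A p) : ∃ Q : Matrix (Fin k) (Fin k) ℝ, Q * Qᵀ = 1 ∧
      Matrix.scalar (Fin k) (p : ℍ[ℝ]) * Mpart A * toQuat Q =
        toQuat Q * Mpart A * Matrix.scalar (Fin k) (p : ℍ[ℝ]) := by
  obtain ⟨g, hg⟩ := h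
  rw [rotateAct_eq, gaugeAct_eq] at hg
  have h2 := congrArg Matrix.toRows₂ hg
  simp only [Matrix.toRows₂_fromRows] at h2
  have hQ : (g.2 : Matrix (Fin k) (Fin k) ℝ) * (g.2 : Matrix (Fin k) (Fin k) ℝ)ᵀ = 1 :=
    mem_orthogonalGroup_iff_transpose.1 g.2.2
  have hQ' := mul_eq_one_comm.1 hQ
  refine ⟨g.2.1, hQ, ?_⟩
  set Q : Matrix (Fin k) (Fin k) ℝ := g.2.1
  set P := Matrix.scalar (Fin k) (p : ℍ[ℝ])
  set P' := Matrix.scalar (Fin k) (star (p : ℍ[ℝ]))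
  have hP : P' * P = 1 := scalar_star_mul_scalar p
  calc P * Mpart A * toQuat Q = P * Mpart A * P' * toQuat Q * P := by
        rw [mul_assoc (P * Mpart A * P'), ← scalar_mul_toQuat, ← mul_assoc (P * Mpart A * P'),
          mul_assoc _ P', hP, mul_one]
    _ = toQuat Q * Mpart A * P := by
        rw [h2, mul_assoc _ (toQuat Qᵀ), ← toQuat_mul, hQ', toQuat_one, mul_one]

/-- The hypothesis says that `p†Q` commutes with `M`, hence with `1 + M² = L†L`. So `L` and `p L p†
Q` have the same Gram matrix, and the symplectic factor between them is the missing `q`. -/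
theorem IsMonopoleData.isEquivariant_of_orthogonal {A : Mat n k} (hA : IsMonopoleData A)
    {p : UnitQuaternion} {Q : Matrix (Fin k) (Fin k) ℝ} (hQ : Q * Qᵀ = 1)
    (h : Matrix.scalar (Fin k) (p : ℍ[ℝ]) * Mpart A * toQuat Q =
      toQuat Q * Mpart A * Matrix.scalar (Fin k) (p : ℍ[ℝ])) : IsEquivariant A p := by
  have hQ' := mul_eq_one_comm.1 hQ
  set P := Matrix.scalar (Fin k) (p : ℍ[ℝ]) with hPdef
  set P' := Matrix.scalar (Fin k) (star (p : ℍ[ℝ])) with hPdef'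
  set Pn := Matrix.scalar (Fin n) (p : ℍ[ℝ]) with hPn
  set M := Mpart A with hM
  set L := Lpart A with hL
  have hP : P' * P = 1 := scalar_star_mul_scalar p
  have hP' : P * P' = 1 := scalar_mul_scalar_star p
  have hPH : Pᴴ = P' := by
    rw [hPdef, hPdef']
    simp [Matrix.diagonal_conjTranspose, Pi.star_def]
  have hPH' : P'ᴴ = P := by rw [← hPH, Matrix.conjTranspose_conjTranspose]
  have hPnH : Pnᴴ = Matrix.scalar (Fin n) (star (p : ℍ[ℝ])) := by
    rw [hPn]
    simp [Matrix.diagonal_conjTranspose, Pi.star_def]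
  have hMrot : P * M * P' = toQuat Q * M * toQuat Qᵀ := by
    calc P * M * P' = P * M * (toQuat Q * toQuat Qᵀ) * P' := by
          rw [toQuat_mul_transpose hQ, mul_one]
      _ = P * M * toQuat Q * (P' * toQuat Qᵀ) := by
          rw [hPdef', scalar_mul_toQuat]; simp only [mul_assoc]
      _ = toQuat Q * M * (P * P') * toQuat Qᵀ := by rw [h]; simp only [mul_assoc]
      _ = _ := by rw [hP', mul_one]
  have hgram : Lᴴ * L = 1 + M * M := by
    have := hA.quadratic
    rw [sub_eq_iff_eq_add, pow_two] at this
    exact this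
  have hcomm : (P' * toQuat Q) * (1 + M * M) = (1 + M * M) * (P' * toQuat Q) := by
    have h1 : (P' * toQuat Q) * M = M * (P' * toQuat Q) := by
      calc (P' * toQuat Q) * M = P' * (toQuat Q * M * P) * P' := by
            simp only [mul_assoc]; rw [hP', mul_one]
        _ = (P' * P) * M * (toQuat Q * P') := by rw [← h]; simp only [mul_assoc]
        _ = _ := by rw [hP, one_mul, scalar_mul_toQuat]
    rw [mul_add, add_mul, mul_one, one_mul, ← mul_assoc, h1, mul_assoc, h1, mul_assoc]
  have hL' : Lᴴ * L = (Pn * L * (P' * toQuat Q))ᴴ * (Pn * L * (P' * toQuat Q)) := by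
    have e1 : (Pn * L * (P' * toQuat Q))ᴴ * (Pn * L * (P' * toQuat Q)) =
        (toQuat Qᵀ * P) * (Lᴴ * (Pnᴴ * Pn) * L) * (P' * toQuat Q) := by
      simp only [Matrix.conjTranspose_mul, hPH', toQuat_conjTranspose, Matrix.mul_assoc]
    rw [e1, hPnH, scalar_star_mul_scalar, Matrix.mul_one, hgram, mul_assoc, ← hcomm,
      ← mul_assoc, mul_assoc (toQuat Qᵀ), ← mul_assoc P, hP', one_mul, ← toQuat_mul, hQ',
      toQuat_one, one_mul]
  obtain ⟨q, hq⟩ := exists_symplectic_mul_eq hA.posDef hL'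
  refine ⟨(q, ⟨Q, mem_orthogonalGroup_iff_transpose.2 hQ⟩), ?_⟩
  rw [rotateAct_eq, gaugeAct_eq]
  congr 1
  change Pn * L * P' = (q : Matrix (Fin n) (Fin n) ℍ[ℝ]) * L * toQuat Qᵀ
  rw [← hq, Matrix.mul_assoc _ (P' * toQuat Q), mul_assoc P', toQuat_mul_transpose hQ, mul_one]

end Actions

/-! ### From orthogonal conjugators to a tangent vector. -/

section Infinitesimal

variable {k : ℕ}

theorem scalar_smul (c : ℝ) (υ : ℍ[ℝ]) :
    Matrix.scalar (Fin k) (c • υ) = c • Matrix.scalar (Fin k) υ := by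
  rw [Matrix.scalar_apply, Matrix.scalar_apply, ← Matrix.diagonal_smul]
  rfl

theorem eq_zero_of_trace_mul_transpose_nonpos {X : Matrix (Fin k) (Fin k) ℝ}
    (h : (X * Xᵀ).trace ≤ 0) : X = 0 := by
  have h1 : (X * Xᵀ).trace = ∑ i, ∑ j, X i j ^ 2 := by
    simp [Matrix.trace, Matrix.mul_apply, pow_two]
  have h0 : ∀ i, 0 ≤ ∑ j, X i j ^ 2 := fun i => Finset.sum_nonneg fun j _ => sq_nonneg _
  have h2 : ∑ i, ∑ j, X i j ^ 2 = 0 :=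
    le_antisymm (h1 ▸ h) (Finset.sum_nonneg fun i _ => h0 i)
  ext1 i j
  have h3 := (Finset.sum_eq_zero_iff_of_nonneg fun i _ => h0 i).1 h2 i (Finset.mem_univ _)
  have h4 := (Finset.sum_eq_zero_iff_of_nonneg fun j _ => sq_nonneg _).1 h3 j (Finset.mem_univ _)
  exact pow_eq_zero_iff (two_ne_zero) |>.1 h4

/-- For orthogonal `Q`, the squared Frobenius norm of `Q - 1` is `2(k - tr Q)`. -/
theorem eq_one_of_card_le_trace {Q : Matrix (Fin k) (Fin k) ℝ} (hQ : Q * Qᵀ = 1)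
    (h : (k : ℝ) ≤ Q.trace) : Q = 1 := by
  refine sub_eq_zero.1 (eq_zero_of_trace_mul_transpose_nonpos ?_)
  have : (Q - 1) * (Q - 1)ᵀ = 1 - Q - Qᵀ + 1 := by
    rw [Matrix.transpose_sub, Matrix.transpose_one, sub_mul, mul_sub, hQ]
    simp only [mul_one, one_mul]
    abel
  rw [this]
  simp only [Matrix.trace_add, Matrix.trace_sub, Matrix.trace_one, Matrix.trace_transpose,
    Fintype.card_fin]
  linarith

theorem continuous_toQuat :
    Continuous (toQuat : Matrix (Fin k) (Fin k) ℝ → Matrix (Fin k) (Fin k) ℍ[ℝ]) :=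
  continuous_id.matrix_map (continuous_algebraMap ℝ ℍ[ℝ])

theorem toQuat_add (R S : Matrix (Fin k) (Fin k) ℝ) : toQuat (R + S) = toQuat R + toQuat S :=
  map_add (Algebra.ofId ℝ ℍ[ℝ]).mapMatrix R S

theorem toQuat_sub (R S : Matrix (Fin k) (Fin k) ℝ) : toQuat (R - S) = toQuat R - toQuat S :=
  map_sub (Algebra.ofId ℝ ℍ[ℝ]).mapMatrix R S

theorem toQuat_neg (R : Matrix (Fin k) (Fin k) ℝ) : toQuat (-R) = -toQuat R :=
  map_neg (Algebra.ofId ℝ ℍ[ℝ]).mapMatrix R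

theorem toQuat_smul (c : ℝ) (R : Matrix (Fin k) (Fin k) ℝ) : toQuat (c • R) = c • toQuat R :=
  map_smul (Algebra.ofId ℝ ℍ[ℝ]).mapMatrix c R

theorem toQuat_exp (R : Matrix (Fin k) (Fin k) ℝ) :
    toQuat (NormedSpace.exp R) = NormedSpace.exp (toQuat R) :=
  NormedSpace.map_exp (Algebra.ofId ℝ ℍ[ℝ]).mapMatrix continuous_toQuat R

theorem exp_mul_transpose_of_skew {R : Matrix (Fin k) (Fin k) ℝ} (hR : Rᵀ = -R) :
    NormedSpace.exp R * (NormedSpace.exp R)ᵀ = 1 := by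
  rw [← Matrix.exp_transpose, hR, ← Matrix.exp_add_of_commute _ _ (Commute.refl R).neg_right,
    add_neg_cancel, NormedSpace.exp_zero]

theorem isCompact_orthogonal : IsCompact {Q : Matrix (Fin k) (Fin k) ℝ | Q * Qᵀ = 1} := by
  have hbox : IsCompact (Set.univ.pi fun _ : Fin k => Set.univ.pi fun _ : Fin k =>
      Set.Icc (-1 : ℝ) 1) :=
    isCompact_univ_pi fun _ => isCompact_univ_pi fun _ => isCompact_Icc
  refine IsCompact.of_isClosed_subset hbox
    (isClosed_eq (continuous_id.matrix_mul continuous_id.matrix_transpose) continuous_const) ?_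
  intro Q hQ i _ j _
  exact abs_le.1 (entry_norm_bound_of_unitary (mem_orthogonalGroup_iff_transpose.2 hQ) i j)

/-- The trace-orthogonal complement of the Lie algebra of the stabilizer of `M` in `O(k)`. -/
def stabilizerComplement (M : Matrix (Fin k) (Fin k) ℍ[ℝ]) :
    Submodule ℝ (Matrix (Fin k) (Fin k) ℝ) where
  carrier := {X | ∀ κ : Matrix (Fin k) (Fin k) ℝ, κᵀ = -κ → Commute M (toQuat κ) →
    (X * κ).trace = 0}
  zero_mem' := by
    intro κ _ _
    simp
  add_mem' := by
    intro X Y hX hY κ h1 h2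
    rw [add_mul, Matrix.trace_add, hX κ h1 h2, hY κ h1 h2, add_zero]
  smul_mem' := by
    intro c X hX κ h1 h2
    rw [smul_mul_assoc, Matrix.trace_smul, hX κ h1 h2, smul_zero]

/-- The derivative at the identity of the equations cutting out `O(k)` and the stabilizer of `M`,
restricted to the complement of their common kernel. -/
noncomputable def infinitesimalDefect (M : Matrix (Fin k) (Fin k) ℍ[ℝ]) :
    stabilizerComplement M →ₗ[ℝ] Matrix (Fin k) (Fin k) ℍ[ℝ] × Matrix (Fin k) (Fin k) ℝ where
  toFun X := (toQuat (X : Matrix (Fin k) (Fin k) ℝ) * M - M * toQuat (X : Matrix (Fin k) (Fin k) ℝ),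
    (X : Matrix (Fin k) (Fin k) ℝ) + (X : Matrix (Fin k) (Fin k) ℝ)ᵀ)
  map_add' X Y := by
    refine Prod.ext ?_ ?_
    · simp only [Submodule.coe_add, toQuat_add, add_mul, mul_add, Prod.fst_add]
      abel
    · simp only [Submodule.coe_add, Matrix.transpose_add, Prod.snd_add]
      abel
  map_smul' c X := by
    refine Prod.ext ?_ ?_
    · simp only [Submodule.coe_smul, toQuat_smul, smul_mul_assoc, mul_smul_comm, Prod.smul_fst,
        smul_sub, RingHom.id_apply]
    · simp only [Submodule.coe_smul, Matrix.transpose_smul, Prod.smul_snd, smul_add,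
        RingHom.id_apply]

/-- Such an `X` lies in the stabilizer algebra and in its complement, so it pairs to zero with
itself. -/
theorem eq_zero_of_mem_stabilizerComplement {M : Matrix (Fin k) (Fin k) ℍ[ℝ]}
    {X : Matrix (Fin k) (Fin k) ℝ} (hX : X ∈ stabilizerComplement M) (hskew : Xᵀ = -X)
    (hcomm : Commute M (toQuat X)) : X = 0 := by
  refine eq_zero_of_trace_mul_transpose_nonpos ?_
  rw [hskew, mul_neg, Matrix.trace_neg, hX X hskew hcomm, neg_zero]

theorem infinitesimalDefect_injective (M : Matrix (Fin k) (Fin k) ℍ[ℝ]) :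
    Function.Injective (infinitesimalDefect M) := by
  refine (injective_iff_map_eq_zero _).2 fun X hX => Subtype.ext ?_
  have h1 := congrArg Prod.fst hX
  have h2 := congrArg Prod.snd hX
  refine eq_zero_of_mem_stabilizerComplement X.2 (eq_neg_of_add_eq_zero_right h2) ?_
  exact (sub_eq_zero.1 h1).symm

/-- The orthogonal matrices carrying `M` to its conjugate by `x`. -/
def conjugators (M : Matrix (Fin k) (Fin k) ℍ[ℝ]) (x : ℍ[ℝ]) : Set (Matrix (Fin k) (Fin k) ℝ) :=
  {Q | Q * Qᵀ = 1 ∧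
    Matrix.scalar (Fin k) x * M * toQuat Q = toQuat Q * M * Matrix.scalar (Fin k) x}

theorem isCompact_conjugators (M : Matrix (Fin k) (Fin k) ℍ[ℝ]) (x : ℍ[ℝ]) :
    IsCompact (conjugators M x) :=
  isCompact_orthogonal.inter_right <| isClosed_eq
    (continuous_const.mul continuous_toQuat)
    ((continuous_toQuat.mul continuous_const).mul continuous_const)

theorem mul_mem_conjugators {M : Matrix (Fin k) (Fin k) ℍ[ℝ]} {x : ℍ[ℝ]}
    {Q S : Matrix (Fin k) (Fin k) ℝ} (hQ : Q ∈ conjugators M x) (hS : S * Sᵀ = 1)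
    (hSM : Commute M (toQuat S)) : Q * S ∈ conjugators M x := by
  refine ⟨?_, ?_⟩
  · rw [Matrix.transpose_mul, mul_assoc, ← mul_assoc S, hS, one_mul, hQ.1]
  · rw [toQuat_mul, ← mul_assoc, hQ.2, mul_assoc _ _ (toQuat S), scalar_mul_toQuat,
      ← mul_assoc, mul_assoc (toQuat Q) M, hSM.eq]
    simp only [mul_assoc]

theorem continuous_trace : Continuous (Matrix.trace : Matrix (Fin k) (Fin k) ℝ → ℝ) :=
  continuous_id.matrix_trace

/-- A conjugator of maximal trace differs from the identity by an element of the complement of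
the stabilizer algebra. -/
theorem sub_one_mem_stabilizerComplement {M : Matrix (Fin k) (Fin k) ℍ[ℝ]} {x : ℍ[ℝ]}
    {Q : Matrix (Fin k) (Fin k) ℝ} (hQ : Q ∈ conjugators M x)
    (hmax : IsMaxOn Matrix.trace (conjugators M x) Q) : Q - 1 ∈ stabilizerComplement M := by
  intro κ hκ hcomm
  have htr : κ.trace = 0 := by
    have := congrArg Matrix.trace hκ
    rw [Matrix.trace_transpose, Matrix.trace_neg] at this
    linarith
  rw [sub_mul, Matrix.trace_sub, one_mul, htr, sub_zero]
  -- The curve `Q exp(sκ)` stays among the conjugators, so its trace is maximal at `s = 0` and the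
  -- derivative `tr(Qκ)` vanishes.
  have hd : HasDerivAt (fun s : ℝ => NormedSpace.exp (s • κ)) κ 0 := by
    have := hasDerivAt_exp_smul_const (𝕂 := ℝ) κ (0 : ℝ)
    rwa [zero_smul, NormedSpace.exp_zero, one_mul] at this
  let T : Matrix (Fin k) (Fin k) ℝ →L[ℝ] ℝ :=
    ⟨(Matrix.traceLinearMap (Fin k) ℝ ℝ).comp (LinearMap.mulLeft ℝ Q),
      continuous_trace.comp (continuous_const.mul continuous_id)⟩
  have hd' : HasDerivAt (fun s : ℝ => (Q * NormedSpace.exp (s • κ)).trace) (Q * κ).trace 0 :=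
    T.hasFDerivAt.comp_hasDerivAt 0 hd
  refine IsLocalMax.hasDerivAt_eq_zero (Eventually.of_forall fun s => ?_) hd'
  simp only [zero_smul, NormedSpace.exp_zero, mul_one]
  refine hmax (mul_mem_conjugators hQ (exp_mul_transpose_of_skew ?_) ?_)
  · rw [Matrix.transpose_smul, hκ, smul_neg]
  · rw [toQuat_exp, toQuat_smul]
    exact (hcomm.smul_right s).exp_right

/-- If every conjugate of `M` by `1 + t υ` lies in the `O(k)`-orbit of `M`, then `[υ, M]` is tangent
to that orbit. -/
theorem exists_skew_of_forall_conjugators_nonempty {M : Matrix (Fin k) (Fin k) ℍ[ℝ]} {υ : ℍ[ℝ]}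
    (h : ∀ t : ℝ, (conjugators M (1 + t • υ)).Nonempty) :
    ∃ R ∈ stabilizerComplement M, Rᵀ = -R ∧
      M * toQuat R - toQuat R * M = Matrix.scalar (Fin k) υ * M - M * Matrix.scalar (Fin k) υ := by
  choose Q hQ hmax using fun i : ℕ => (isCompact_conjugators M (1 + (1 / ((i : ℝ) + 1)) • υ)
    ).exists_isMaxOn (h _) continuous_trace.continuousOn
  have : FirstCountableTopology (Matrix (Fin k) (Fin k) ℝ) :=
    inferInstanceAs (FirstCountableTopology (Fin k → Fin k → ℝ))
  obtain ⟨Q₀, hQ₀, φ, hφ, hlim⟩ := isCompact_orthogonal.tendsto_subseq fun i => (hQ i).1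
  set U := Matrix.scalar (Fin k) υ with hU
  let t : ℕ → ℝ := fun i => 1 / ((φ i : ℝ) + 1)
  have ht0 : ∀ i, 0 < t i := fun i => by positivity
  have ht : Tendsto t atTop (𝓝 0) :=
    (tendsto_one_div_add_atTop_nhds_zero_nat (𝕜 := ℝ)).comp hφ.tendsto_atTop
  have hscalar : ∀ s : ℝ, Matrix.scalar (Fin k) (1 + s • υ) = 1 + s • U := fun s => by
    rw [map_add, map_one, hU, scalar_smul]
  have heq : ∀ i, (1 + t i • U) * M * toQuat (Q (φ i)) = toQuat (Q (φ i)) * M * (1 + t i • U) :=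
    fun i => by
      have := (hQ (φ i)).2
      rwa [hscalar] at this
  have hlimq : Tendsto (fun i => toQuat (Q (φ i))) atTop (𝓝 (toQuat Q₀)) :=
    (continuous_toQuat.tendsto Q₀).comp hlim
  have hlimU : Tendsto (fun i => 1 + t i • U) atTop (𝓝 1) := by
    simpa using (ht.smul_const U).const_add 1
  have hstab : Commute M (toQuat Q₀) := by
    have h1 : Tendsto (fun i => (1 + t i • U) * M * toQuat (Q (φ i))) atTop
        (𝓝 (1 * M * toQuat Q₀)) := (hlimU.mul_const M).mul hlimq
    have h2 : Tendsto (fun i => toQuat (Q (φ i)) * M * (1 + t i • U)) atTop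
        (𝓝 (toQuat Q₀ * M * 1)) := (hlimq.mul_const M).mul hlimU
    have h3 := tendsto_nhds_unique (h1.congr heq) h2
    rwa [one_mul, mul_one] at h3
  have hQ₀' : Q₀ᵀ * Q₀ = 1 := mul_eq_one_comm.1 hQ₀
  have hstab' : Commute M (toQuat Q₀ᵀ) := by
    have e1 : toQuat Q₀ * toQuat Q₀ᵀ = 1 := toQuat_mul_transpose hQ₀
    have e2 : toQuat Q₀ᵀ * toQuat Q₀ = 1 := by rw [← toQuat_mul, hQ₀', toQuat_one]
    calc M * toQuat Q₀ᵀ = toQuat Q₀ᵀ * (toQuat Q₀ * M) * toQuat Q₀ᵀ := by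
          rw [← mul_assoc (toQuat Q₀ᵀ), e2, one_mul]
      _ = toQuat Q₀ᵀ * M := by rw [← hstab.eq]; simp only [mul_assoc]; rw [e1, mul_one]
  -- Right multiplication by the stabilizer element `Q₀ᵀ` keeps each `Q (φ i)` a conjugator, so
  -- maximality gives `tr(Q₀Q₀ᵀ) ≤ tr Q₀` in the limit.
  have hone : Q₀ = 1 := by
    refine eq_one_of_card_le_trace hQ₀ ?_
    have h1 : Tendsto (fun i => (Q (φ i) * Q₀ᵀ).trace) atTop (𝓝 (Q₀ * Q₀ᵀ).trace) :=
      (continuous_trace.tendsto _).comp (hlim.mul_const _)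
    have h2 : Tendsto (fun i => (Q (φ i)).trace) atTop (𝓝 Q₀.trace) :=
      (continuous_trace.tendsto _).comp hlim
    have h3 := le_of_tendsto_of_tendsto' h1 h2 fun i =>
      hmax (φ i) (mul_mem_conjugators (hQ (φ i)) (by rwa [Matrix.transpose_transpose]) hstab')
    have h4 : Q₀ * Q₀ᵀ = 1 := hQ₀
    rwa [h4, Matrix.trace_one, Fintype.card_fin] at h3
  let X : ℕ → stabilizerComplement M := fun i =>
    ⟨Q (φ i) - 1, sub_one_mem_stabilizerComplement (hQ (φ i)) (hmax (φ i))⟩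
  have hX : Tendsto (fun i => Q (φ i) - 1) atTop (𝓝 0) := by
    have := hlim.sub_const 1
    rwa [hone, sub_self] at this
  have hXq : Tendsto (fun i => toQuat (Q (φ i) - 1)) atTop (𝓝 0) := by
    have := (continuous_toQuat.tendsto 0).comp hX
    rwa [show toQuat (0 : Matrix (Fin k) (Fin k) ℝ) = 0 from
      map_zero (Algebra.ofId ℝ ℍ[ℝ]).mapMatrix] at this
  -- The correction to `[υ, M]` tends to zero and makes the first component of the linearised
  -- equation exact. The only remaining error is the quadratic one from `QQᵀ = 1`.
  let a : ℕ → Matrix (Fin k) (Fin k) ℍ[ℝ] × Matrix (Fin k) (Fin k) ℝ := fun i =>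
    (U * M - M * U + (U * M * toQuat (Q (φ i) - 1) - toQuat (Q (φ i) - 1) * M * U), 0)
  have ha : Tendsto a atTop (𝓝 (U * M - M * U, 0)) := by
    refine Tendsto.prodMk_nhds ?_ tendsto_const_nhds
    have := ((hXq.const_mul (U * M)).sub ((hXq.mul_const M).mul_const U)).const_add (U * M - M * U)
    simpa only [mul_zero, zero_mul, sub_self, add_zero] using this
  have he : Tendsto (fun i => ‖(Q (φ i) - 1)ᵀ‖) atTop (𝓝 0) := by
    have h1 : Tendsto (fun i => (Q (φ i) - 1)ᵀ) atTop (𝓝 0) := by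
      have h2 : Continuous fun Y : Matrix (Fin k) (Fin k) ℝ => Yᵀ :=
        continuous_id.matrix_transpose
      have h3 := (h2.tendsto 0).comp hX
      rwa [Matrix.transpose_zero] at h3
    simpa only [norm_zero] using h1.norm
  have hF : ∀ i, infinitesimalDefect M (X i) - t i • a i =
      (0, -((Q (φ i) - 1) * (Q (φ i) - 1)ᵀ)) := by
    intro i
    refine Prod.ext ?_ ?_
    · change (toQuat (Q (φ i) - 1) * M - M * toQuat (Q (φ i) - 1)) - t i •
        (U * M - M * U + (U * M * toQuat (Q (φ i) - 1) - toQuat (Q (φ i) - 1) * M * U)) = 0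
      have := heq i
      have e : toQuat (Q (φ i)) = 1 + toQuat (Q (φ i) - 1) := by
        rw [toQuat_sub, toQuat_one, add_sub_cancel]
      rw [e] at this
      generalize toQuat (Q (φ i) - 1) = Y at this ⊢
      simp only [add_mul, mul_add, one_mul, mul_one, smul_mul_assoc, mul_smul_comm, smul_add,
        smul_sub] at this ⊢
      refine neg_eq_zero.1 (Eq.trans ?_ (sub_eq_zero.2 this))
      abel
    · change (Q (φ i) - 1 + (Q (φ i) - 1)ᵀ) - t i • (0 : Matrix (Fin k) (Fin k) ℝ) = _
      have h1 : Q (φ i) * (Q (φ i))ᵀ = 1 := (hQ (φ i)).1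
      simp only [smul_zero, sub_zero, Matrix.transpose_sub, Matrix.transpose_one, sub_mul, mul_sub,
        h1, mul_one, one_mul]
      abel
  obtain ⟨Y, hY⟩ := mem_range_of_tendsto_of_norm_sub_le (infinitesimalDefect M)
    (infinitesimalDefect_injective M) X t _ a _ ht0 he ha fun i => by
      rw [hF i, Prod.norm_mk, norm_zero, norm_neg, max_eq_right (norm_nonneg _)]
      exact norm_mul_le _ _
  have hY1 : toQuat (Y : Matrix (Fin k) (Fin k) ℝ) * M - M * toQuat (Y : Matrix (Fin k) (Fin k) ℝ) =
      U * M - M * U := congrArg Prod.fst hY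
  have hY2 : (Y : Matrix (Fin k) (Fin k) ℝ) + (Y : Matrix (Fin k) (Fin k) ℝ)ᵀ = 0 :=
    congrArg Prod.snd hY
  -- The sign is reversed because `Y` approximates `(Q - 1)/t`, while the bracket `[M, R]` has `M`
  -- on the left.
  refine ⟨-Y, neg_mem Y.2, ?_, ?_⟩
  · rw [Matrix.transpose_neg, eq_neg_of_add_eq_zero_right hY2]
  · rw [toQuat_neg, ← hY1]
    noncomm_ring

end Infinitesimal

/-! ### Assembling the representation, and exponentiating it. -/

section Representation

variable {k : ℕ}

theorem mem_sp1_iff {x : ℍ[ℝ]} : x ∈ sp1 ↔ star x = -x := Iff.rfl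

/-- Skew-symmetric matrices in the complement of the stabilizer algebra implementing `[υ, M]`. -/
structure IsInfinitesimalRotation (M : Matrix (Fin k) (Fin k) ℍ[ℝ]) (υ : ℍ[ℝ])
    (R : Matrix (Fin k) (Fin k) ℝ) : Prop where
  mem : R ∈ stabilizerComplement M
  skew : Rᵀ = -R
  lie_eq : ⁅M, toQuat R⁆ = ⁅Matrix.scalar (Fin k) υ, M⁆

namespace IsInfinitesimalRotation

variable {M : Matrix (Fin k) (Fin k) ℍ[ℝ]} {υ ω : ℍ[ℝ]} {R S : Matrix (Fin k) (Fin k) ℝ}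

theorem unique (hR : IsInfinitesimalRotation M υ R) (hS : IsInfinitesimalRotation M υ S) :
    R = S := by
  refine sub_eq_zero.1 (eq_zero_of_mem_stabilizerComplement (sub_mem hR.mem hS.mem) ?_ ?_)
  · rw [Matrix.transpose_sub, hR.skew, hS.skew]
    abel
  · rw [commute_iff_lie_eq, toQuat_sub, lie_sub, hR.lie_eq, hS.lie_eq, sub_self]

theorem add (hR : IsInfinitesimalRotation M υ R) (hS : IsInfinitesimalRotation M ω S) :
    IsInfinitesimalRotation M (υ + ω) (R + S) where
  mem := add_mem hR.mem hS.mem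
  skew := by
    rw [Matrix.transpose_add, hR.skew, hS.skew, neg_add]
  lie_eq := by
    rw [toQuat_add, lie_add, hR.lie_eq, hS.lie_eq, map_add, add_lie]

theorem smul (c : ℝ) (hR : IsInfinitesimalRotation M υ R) :
    IsInfinitesimalRotation M (c • υ) (c • R) where
  mem := Submodule.smul_mem _ c hR.mem
  skew := by rw [Matrix.transpose_smul, hR.skew, smul_neg]
  lie_eq := by
    have := hR.lie_eq
    rw [Ring.lie_def, Ring.lie_def] at this ⊢
    rw [toQuat_smul, scalar_smul, mul_smul_comm, smul_mul_assoc, smul_mul_assoc, mul_smul_comm,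
      ← smul_sub, ← smul_sub, this]

theorem lie_scalar_toQuat (υ : ℍ[ℝ]) (R : Matrix (Fin k) (Fin k) ℝ) :
    ⁅Matrix.scalar (Fin k) υ, toQuat R⁆ = 0 := by
  rw [Ring.lie_def, scalar_mul_toQuat, sub_self]

theorem toQuat_lie (R S : Matrix (Fin k) (Fin k) ℝ) : toQuat ⁅R, S⁆ = ⁅toQuat R, toQuat S⁆ := by
  rw [Ring.lie_def, Ring.lie_def, toQuat_sub, toQuat_mul, toQuat_mul]

theorem lie (hR : IsInfinitesimalRotation M υ R) (hS : IsInfinitesimalRotation M ω S) :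
    IsInfinitesimalRotation M ⁅υ, ω⁆ ⁅R, S⁆ where
  mem := by
    intro κ hκ hcomm
    -- Invariance of the trace form moves the bracket onto `κ`. The stabilizer algebra is stable
    -- under `[S, ·]`: by Jacobi `[M, [S, κ]] = [[ω, M], κ]`, which vanishes since `κ` commutes with
    -- `M` and with the scalar `ω`.
    have h1 : (⁅R, S⁆ * κ).trace = (R * ⁅S, κ⁆).trace := by
      rw [Ring.lie_def, Ring.lie_def, sub_mul, mul_sub, Matrix.trace_sub, Matrix.trace_sub,
        mul_assoc, mul_assoc, Matrix.trace_mul_comm S, mul_assoc]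
    rw [h1]
    refine hR.mem _ ?_ ?_
    · rw [Ring.lie_def, Matrix.transpose_sub, Matrix.transpose_mul, Matrix.transpose_mul, hκ,
        hS.skew]
      noncomm_ring
    · rw [commute_iff_lie_eq, toQuat_lie, leibniz_lie, hS.lie_eq, hcomm.lie_eq, lie_zero, add_zero,
        lie_lie, hcomm.lie_eq, lie_scalar_toQuat, lie_zero, lie_zero, sub_zero]
  skew := by
    rw [Ring.lie_def, Matrix.transpose_sub, Matrix.transpose_mul, Matrix.transpose_mul, hR.skew,
      hS.skew]
    noncomm_ring
  lie_eq := by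
    have e : Matrix.scalar (Fin k) ⁅υ, ω⁆ =
        ⁅Matrix.scalar (Fin k) υ, Matrix.scalar (Fin k) ω⁆ := by
      rw [Ring.lie_def, Ring.lie_def, map_sub, map_mul, map_mul]
    have h0 : ∀ (x : ℍ[ℝ]) (T : Matrix (Fin k) (Fin k) ℝ),
        ⁅toQuat T, Matrix.scalar (Fin k) x⁆ = 0 := fun x T => by
      rw [← lie_skew, lie_scalar_toQuat, neg_zero]
    rw [e, toQuat_lie, leibniz_lie, hR.lie_eq, hS.lie_eq, lie_lie, lie_lie, lie_scalar_toQuat,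
      lie_zero, sub_zero, hS.lie_eq, leibniz_lie (toQuat R), h0, zero_lie, zero_add,
      ← lie_skew (toQuat R), lie_neg, hR.lie_eq, sub_eq_add_neg]

end IsInfinitesimalRotation

theorem exists_representation {M : Matrix (Fin k) (Fin k) ℍ[ℝ]}
    (h : ∀ υ ∈ sp1, ∃ R, IsInfinitesimalRotation M υ R) :
    ∃ ρ : sp1 →ₗ⁅ℝ⁆ so k, ∀ υ : sp1,
      ⁅M, toQuat (ρ υ : Matrix (Fin k) (Fin k) ℝ)⁆ = ⁅Matrix.scalar (Fin k) (υ : ℍ[ℝ]), M⁆ := by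
  choose r hr using fun υ : sp1 => h υ υ.2
  refine ⟨{ toFun := fun υ => ⟨r υ, (LieAlgebra.Orthogonal.mem_so _ _ _).2 (hr υ).skew⟩
            map_add' := fun υ ω => Subtype.ext ((hr (υ + ω)).unique ((hr υ).add (hr ω)))
            map_smul' := fun c υ => Subtype.ext ((hr (c • υ)).unique ((hr υ).smul c))
            map_lie' := fun {υ ω} => Subtype.ext ((hr ⁅υ, ω⁆).unique ((hr υ).lie (hr ω))) },
    fun υ => (hr υ).lie_eq⟩

theorem exists_exp_eq_coe_add {c : ℝ} {b : ℍ[ℝ]} (hb : b.re = 0) (h : c ^ 2 + ‖b‖ ^ 2 = 1) :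
    ∃ υ ∈ sp1, NormedSpace.exp υ = (c : ℍ[ℝ]) + b := by
  obtain ⟨u, hu, hu1, hbu⟩ : ∃ u : ℍ[ℝ], u.re = 0 ∧ ‖u‖ = 1 ∧ ‖b‖ • u = b := by
    by_cases h0 : b = 0
    -- Here `c = ±1`. Any unit axis serves, but it must be nonzero, since `c = -1` needs angle `π`.
    · obtain ⟨i, hi, hi1⟩ : ∃ i : ℍ[ℝ], i.re = 0 ∧ Quaternion.normSq i = 1 :=
        ⟨⟨0, 1, 0, 0⟩, rfl, (Quaternion.normSq_def' _).trans (by norm_num)⟩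
      rw [Quaternion.normSq_eq_norm_mul_self] at hi1
      refine ⟨i, hi, ?_, by rw [h0, norm_zero, zero_smul]⟩
      nlinarith [norm_nonneg i]
    · have h1 : ‖b‖ ≠ 0 := norm_ne_zero_iff.2 h0
      refine ⟨‖b‖⁻¹ • b, by simp [hb], ?_, ?_⟩
      · rw [norm_smul, norm_inv, norm_norm, inv_mul_cancel₀ h1]
      · rw [smul_smul, mul_inv_cancel₀ h1, one_smul]
  set θ := Real.arccos c
  have hcos : Real.cos θ = c := Real.cos_arccos (by nlinarith [sq_nonneg ‖b‖])
    (by nlinarith [sq_nonneg ‖b‖])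
  have hsin : Real.sin θ = ‖b‖ := by
    rw [Real.sin_arccos, ← h, add_sub_cancel_left, Real.sqrt_sq (norm_nonneg _)]
  have hθ : ‖θ • u‖ = θ := by
    rw [norm_smul, hu1, mul_one, Real.norm_of_nonneg (Real.arccos_nonneg _)]
  have hre : (θ • u).re = 0 := by simp [hu]
  refine ⟨θ • u, Quaternion.star_eq_neg.2 hre, ?_⟩
  have hdiv : Real.sin θ / θ * θ = Real.sin θ := by
    by_cases h0 : θ = 0
    · rw [h0, Real.sin_zero, zero_div, zero_mul]
    · exact div_mul_cancel₀ _ h0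
  rw [Quaternion.exp_of_re_eq_zero _ hre, hθ, smul_smul, hdiv, hcos, hsin, hbu]

theorem exists_exp_eq (p : UnitQuaternion) : ∃ υ ∈ sp1, NormedSpace.exp υ = (p : ℍ[ℝ]) := by
  have hp : Quaternion.normSq (p : ℍ[ℝ]) = 1 := by
    have h1 := Unitary.mul_star_self_of_mem p.2
    rw [Quaternion.self_mul_star] at h1
    exact Quaternion.coe_injective h1
  have hsq : (p : ℍ[ℝ]).re ^ 2 + ‖(p : ℍ[ℝ]).im‖ ^ 2 = 1 := by
    rw [pow_two ‖_‖, ← Quaternion.normSq_eq_norm_mul_self, Quaternion.normSq_def']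
    rw [Quaternion.normSq_def'] at hp
    simp only [Quaternion.re_im, Quaternion.imI_im, Quaternion.imJ_im, Quaternion.imK_im]
    linarith
  obtain ⟨υ, hυ, h⟩ := exists_exp_eq_coe_add (Quaternion.re_im _) hsq
  exact ⟨υ, hυ, h.trans (Quaternion.re_add_im _)⟩

/-- The equation defining `conjugators` is homogeneous in `x`, so normalising `x` changes nothing.
This allows the path `1 + tυ`, affine in `t`, in place of `exp(tυ)`. -/
theorem IsSphericallySymmetric.conjugators_nonempty {n : ℕ} {A : Mat n k}
    (h : IsSphericallySymmetric A) {x : ℍ[ℝ]} (hx : x ≠ 0) : (conjugators (Mpart A) x).Nonempty := by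
  have hn : ‖x‖ ≠ 0 := norm_ne_zero_iff.2 hx
  have hu : ‖x‖⁻¹ • x ∈ UnitQuaternion := by
    have h1 : Quaternion.normSq (‖x‖⁻¹ • x) = 1 := by
      rw [Quaternion.normSq_eq_norm_mul_self, norm_smul, norm_inv, norm_norm, inv_mul_cancel₀ hn,
        one_mul]
    rw [Unitary.mem_iff, Quaternion.self_mul_star, Quaternion.star_mul_self, h1]
    exact ⟨rfl, rfl⟩
  obtain ⟨Q, hQ, hQ'⟩ := (h ⟨_, hu⟩).exists_orthogonal
  refine ⟨Q, hQ, ?_⟩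
  dsimp only at hQ'
  rw [scalar_smul, smul_mul_assoc, smul_mul_assoc, mul_smul_comm] at hQ'
  exact smul_right_injective _ (inv_ne_zero hn) hQ'

theorem one_add_smul_ne_zero {υ : ℍ[ℝ]} (hυ : υ ∈ sp1) (t : ℝ) : 1 + t • υ ≠ 0 := by
  intro h
  have h1 : υ.re = 0 := by
    have := congrArg (fun x : ℍ[ℝ] => x.re) (mem_sp1_iff.1 hυ)
    simp at this
    linarith
  have := congrArg (fun x : ℍ[ℝ] => x.re) h
  simp [h1] at this

theorem exists_orthogonal_of_lie_eq {M : Matrix (Fin k) (Fin k) ℍ[ℝ]} {υ : ℍ[ℝ]}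
    {R : Matrix (Fin k) (Fin k) ℝ} (hR : Rᵀ = -R)
    (h : ⁅M, toQuat R⁆ = ⁅Matrix.scalar (Fin k) υ, M⁆) :
    (conjugators M (NormedSpace.exp υ)).Nonempty := by
  let _ : NormedAlgebra ℚ ℍ[ℝ] := .restrictScalars ℚ ℝ ℍ[ℝ]
  set S := Matrix.scalar (Fin k) υ with hS
  have hE : Matrix.scalar (Fin k) (NormedSpace.exp υ) = NormedSpace.exp S := by
    simp only [hS, Matrix.scalar_apply]
    rw [Matrix.exp_diagonal]
    congr 1
    exact (Pi.exp_def fun _ : Fin k => υ).symm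
  have hcomm : Commute M (S + toQuat R) := by
    rw [commute_iff_lie_eq, lie_add, h, ← lie_skew, neg_add_cancel]
  have h1 : Commute M (NormedSpace.exp S * NormedSpace.exp (toQuat R)) := by
    rw [← Matrix.exp_add_of_commute _ _ (scalar_mul_toQuat υ R)]
    exact hcomm.exp_right
  have h2 : (NormedSpace.exp R)ᵀ * NormedSpace.exp R = 1 :=
    mul_eq_one_comm.1 (exp_mul_transpose_of_skew hR)
  have h3 : toQuat (NormedSpace.exp R) * toQuat (NormedSpace.exp R)ᵀ = 1 :=
    toQuat_mul_transpose (exp_mul_transpose_of_skew hR)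
  have h4 : toQuat (NormedSpace.exp R)ᵀ * toQuat (NormedSpace.exp R) = 1 := by
    rw [← toQuat_mul, h2, toQuat_one]
  -- Since `M` commutes with `exp υ · exp R`, conjugating `M` by `exp υ` is conjugating it by the
  -- inverse of `exp R`, which is its transpose.
  refine ⟨(NormedSpace.exp R)ᵀ, by rwa [Matrix.transpose_transpose], ?_⟩
  rw [hE]
  rw [← toQuat_exp] at h1
  set E := NormedSpace.exp S
  set P := toQuat (NormedSpace.exp R)
  set P' := toQuat (NormedSpace.exp R)ᵀ
  have hPE : E * P' = P' * E := by rw [← hE]; exact scalar_mul_toQuat _ _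
  have hPE' : E * P = P * E := by rw [← hE]; exact scalar_mul_toQuat _ _
  calc E * M * P' = P' * P * (E * M * P') := by rw [h4, one_mul]
    _ = P' * ((E * P) * M) * P' := by rw [hPE']; simp only [mul_assoc]
    _ = P' * M * E * (P * P') := by rw [← h1.eq]; simp only [mul_assoc]
    _ = P' * M * E := by rw [h3, mul_one]

end Representation

end HyperbolicMonopole

theorem mainTheorem1 (n k : ℕ) (A : HyperbolicMonopole.Mat n k)
    (hA : HyperbolicMonopole.IsMonopoleData A) :
    HyperbolicMonopole.IsSphericallySymmetric A ↔
      ∃ ρ : HyperbolicMonopole.sp1 →ₗ⁅ℝ⁆ HyperbolicMonopole.so k,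
        ∀ υ : HyperbolicMonopole.sp1,
          ⁅HyperbolicMonopole.Mpart A,
              HyperbolicMonopole.toQuat (ρ υ : Matrix (Fin k) (Fin k) ℝ)⁆ =
            ⁅Matrix.scalar (Fin k) (υ : ℍ[ℝ]), HyperbolicMonopole.Mpart A⁆ := by
  constructor
  · intro h
    refine HyperbolicMonopole.exists_representation fun υ hυ => ?_
    obtain ⟨R, h1, h2, h3⟩ :=
      HyperbolicMonopole.exists_skew_of_forall_conjugators_nonempty fun t =>
        h.conjugators_nonempty (HyperbolicMonopole.one_add_smul_ne_zero hυ t)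
    exact ⟨R, h1, h2, h3⟩
  · rintro ⟨ρ, hρ⟩ p
    obtain ⟨υ, hυ, hp⟩ := HyperbolicMonopole.exists_exp_eq p
    obtain ⟨Q, hQ, hQ'⟩ := HyperbolicMonopole.exists_orthogonal_of_lie_eq
      ((LieAlgebra.Orthogonal.mem_so _ _ _).1 (ρ ⟨υ, hυ⟩).2) (hρ ⟨υ, hυ⟩)
    rw [hp] at hQ'
    exact hA.isEquivariant_of_orthogonal hQ hQ'
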